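/- A biframe $L=(L_0,L_1,L_2)$ consists of a frame $L_0$ (the ambient frame) and two subframes $L_1,L_2\subseteq L_0$ such that every element of $L_0$ is a join of finite meets of elements of $L_1\cup L_2$. A biframe map $f\colon L\to M$ is a frame homomorphism $f\colon L_0\to M_0$ with $f[L_1]\subseteq M_1$ and $f[L_2]\subseteq M_2$. Throughout, $a^{*}$ denotes the pseudocomplement of $a$ in the ambient frame. For a biframe $L$, let $\mathcal{I}_L$ be the least frame congruence on $L_0$ containing all pairs $(a,a^{**})$ with $a\in L_1\cup L_2$, let $q\colon L_0\to L_0/\mathcal{I}_L$ be the quotient map, and let $q_*$ be its right adjoint. The image $q_*[L_0/\mathcal{I}_L]\subseteq L_0$ is a frame in the order inherited from $L_0$, and $$\mathfrak{B}L=\bigl(q_*[L_0/\mathcal{I}_L],\ \{a^{**}: a\in L_1\},\ \{a^{**}: a\in L_2\}\bigr)$$ is a biframe. Let $\beta_L\colon L\to\mathfrak{B}L$ be the biframe map $a\mapsto q_*(q(a))$ (so that $\beta_L(a)=a^{**}$ for $a\in L_1\cup L_2$). **Theorem.** Let $f\colon L\to M$ be a biframe map. There exists a biframe map $\hat f\colon\mathfrak{B}L\to\mathfrak{B}M$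 with $\hat f\circ\beta_L=\beta_M\circ f$ if and only if $f(a^{**})\le f(a)^{**}$ for all $a\in L_1\cup L_2$, where the pseudocomplements are computed in the ambient frames $L_0$ and $M_0$ respectively. -/

import Mathlib

universe u v w

/-! ### Frame congruences and quotient frames -/

/-- A frame congruence on a frame: an equivalence relation that respects finite meets and
arbitrary joins (a family of related pairs is given as a set of pairs). -/
structure FrameCongruence (α : Type u) [Order.Frame α] extends Setoid α where
  inf_rel : ∀ {a b c d : α}, r a b → r c d → r (a ⊓ c) (b ⊓ d)
  sSup_rel : ∀ S : Set (α × α), (∀ p ∈ S, r p.1 p.2) →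
    r (sSup (Prod.fst '' S)) (sSup (Prod.snd '' S))

namespace FrameCongruence

variable {α : Type u} [Order.Frame α]

/-- The least frame congruence containing a relation `R`: the intersection of all frame
congruences that contain `R`. -/
def generate (R : α → α → Prop) : FrameCongruence α where
  r a b := ∀ C : FrameCongruence α, (∀ x y, R x y → C.r x y) → C.r a b
  iseqv :=
    { refl := fun a C _ => C.iseqv.refl a
      symm := fun h C hC => C.iseqv.symm (h C hC)
      trans := fun h k C hC => C.iseqv.trans (h C hC) (k C hC) }
  inf_rel h k C hC := C.inf_rel (h C hC) (k C hC)
  sSup_rel S hS C hC := C.sSup_rel S fun p hp => hS p hp C hC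

theorem generate_of {R : α → α → Prop} {a b : α} (h : R a b) : (generate R).r a b :=
  fun _ hC => hC a b h

theorem generate_le {R : α → α → Prop} (C : FrameCongruence α) (hC : ∀ x y, R x y → C.r x y)
    {a b : α} (h : (generate R).r a b) : C.r a b :=
  h C hC

/-- The kernel of a frame homomorphism. -/
def ker {β : Type v} [Order.Frame β] (f : FrameHom α β) : FrameCongruence α where
  r a b := f a = f b
  iseqv := ⟨fun _ => rfl, fun h => h.symm, fun h k => h.trans k⟩
  inf_rel h k := by
    rw [map_inf, map_inf, show f _ = f _ from h, show f _ = f _ from k]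
  sSup_rel S hS := by
    rw [map_sSup, map_sSup, Set.image_image, Set.image_image]
    exact congrArg sSup (Set.image_congr fun p hp => hS p hp)

variable (C : FrameCongruence α)

/-- The set of classes `⟨a⟩` of a frame congruence. -/
def QuotientFrame : Type u := Quotient C.toSetoid

/-- The class `⟨a⟩` of `a`. -/
def cls (a : α) : C.QuotientFrame := Quotient.mk C.toSetoid a

theorem cls_eq {a b : α} : C.cls a = C.cls b ↔ C.r a b := Quotient.eq (r := C.toSetoid)

theorem cls_surjective : Function.Surjective C.cls := Quotient.exists_rep

/-- The meet operation `⟨a⟩ ⊓ ⟨b⟩ = ⟨a ⊓ b⟩`. -/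
def meet : C.QuotientFrame → C.QuotientFrame → C.QuotientFrame :=
  Quotient.map₂ (· ⊓ ·) fun _ _ h _ _ k => C.inf_rel h k

theorem cls_meet (a b : α) : C.meet (C.cls a) (C.cls b) = C.cls (a ⊓ b) := rfl

/-- The order of the quotient: `⟨a⟩ ≤ ⟨b⟩` if and only if `⟨a ⊓ b⟩ = ⟨a⟩`. -/
instance : SemilatticeInf C.QuotientFrame where
  le x y := C.meet x y = x
  le_refl x := by
    obtain ⟨a, rfl⟩ := C.cls_surjective x
    rw [cls_meet, inf_idem]
  le_trans x y z h k := by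
    obtain ⟨a, rfl⟩ := C.cls_surjective x
    obtain ⟨b, rfl⟩ := C.cls_surjective y
    obtain ⟨c, rfl⟩ := C.cls_surjective z
    rw [← h, cls_meet, cls_meet, inf_assoc, ← cls_meet C a, ← cls_meet C b, k, cls_meet]
  le_antisymm x y h k := by
    obtain ⟨a, rfl⟩ := C.cls_surjective x
    obtain ⟨b, rfl⟩ := C.cls_surjective y
    rw [← h, cls_meet, inf_comm, ← cls_meet, k]
  inf := C.meet
  inf_le_left x y := by
    obtain ⟨a, rfl⟩ := C.cls_surjective x
    obtain ⟨b, rfl⟩ := C.cls_surjective y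
    rw [cls_meet, cls_meet, inf_right_comm, inf_idem]
  inf_le_right x y := by
    obtain ⟨a, rfl⟩ := C.cls_surjective x
    obtain ⟨b, rfl⟩ := C.cls_surjective y
    rw [cls_meet, cls_meet, inf_assoc, inf_idem]
  le_inf x y z h k := by
    obtain ⟨a, rfl⟩ := C.cls_surjective x
    obtain ⟨b, rfl⟩ := C.cls_surjective y
    obtain ⟨c, rfl⟩ := C.cls_surjective z
    rw [cls_meet, cls_meet, ← inf_assoc, ← cls_meet C (a ⊓ b), ← cls_meet C a, h, k]

theorem cls_inf (a b : α) : C.cls (a ⊓ b) = C.cls a ⊓ C.cls b := rfl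

theorem cls_mono {a b : α} (h : a ≤ b) : C.cls a ≤ C.cls b := by
  rw [← inf_eq_left, ← cls_inf, inf_eq_left.2 h]

/-- The join of a set of classes is the class of the join of all their members. -/
instance : SupSet C.QuotientFrame := ⟨fun S => C.cls (sSup {a | C.cls a ∈ S})⟩

theorem sSup_def (S : Set C.QuotientFrame) : sSup S = C.cls (sSup {a | C.cls a ∈ S}) := rfl

theorem isLUB_sSup (S : Set C.QuotientFrame) : IsLUB S (sSup S) := by
  constructor
  · intro x hx
    obtain ⟨a, rfl⟩ := C.cls_surjective x
    exact C.cls_mono (le_sSup hx)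
  · intro y hy
    obtain ⟨b, rfl⟩ := C.cls_surjective y
    rw [sSup_def, ← inf_eq_left, ← cls_inf, cls_eq, sSup_inf_eq, ← sSup_image]
    have key := C.sSup_rel ((fun a => (a ⊓ b, a)) '' {a | C.cls a ∈ S}) (by
      rintro _ ⟨a, ha, rfl⟩
      exact C.cls_eq.1 (by rw [cls_inf]; exact inf_eq_left.2 (hy ha)))
    simpa only [Set.image_image, Set.image_id'] using key

instance : CompleteLattice C.QuotientFrame where
  __ := (inferInstance : SemilatticeInf C.QuotientFrame)
  __ := completeLatticeOfSup C.QuotientFrame C.isLUB_sSup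

theorem cls_sSup (S : Set α) : C.cls (sSup S) = sSup (C.cls '' S) := by
  refine le_antisymm ?_ (sSup_le ?_)
  · exact C.cls_mono (sSup_le_sSup fun a ha => ⟨a, ha, rfl⟩)
  · rintro _ ⟨a, ha, rfl⟩
    exact C.cls_mono (le_sSup ha)

/-- The quotient frame `α / C`. -/
instance : Order.Frame C.QuotientFrame :=
  Order.Frame.ofMinimalAxioms
    { inf_sSup_le_iSup_inf := by
        intro x S
        obtain ⟨a, rfl⟩ := C.cls_surjective x
        rw [sSup_def, ← cls_inf, inf_sSup_eq, ← sSup_image, cls_sSup]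
        refine sSup_le ?_
        rintro _ ⟨_, ⟨b, hb, rfl⟩, rfl⟩
        exact le_iSup₂_of_le (C.cls b) hb (C.cls_inf a b).le }

/-- The quotient map `a ↦ ⟨a⟩`. -/
def proj : FrameHom α C.QuotientFrame where
  toFun := C.cls
  map_inf' := C.cls_inf
  map_top' := top_le_iff.1 (by
    obtain ⟨a, ha⟩ := C.cls_surjective ⊤
    rw [← ha]
    exact C.cls_mono le_top)
  map_sSup' := C.cls_sSup

theorem proj_eq {a b : α} : C.proj a = C.proj b ↔ C.r a b := C.cls_eq

theorem proj_surjective : Function.Surjective C.proj := C.cls_surjective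

end FrameCongruence

/-! ### Right adjoints and the sublocale set of a congruence -/

/-- The right adjoint `f_*` of a frame homomorphism `f`. -/
def FrameHom.rightAdjoint {α : Type u} {β : Type v} [Order.Frame α] [Order.Frame β]
    (f : FrameHom α β) (y : β) : α :=
  sSup {a | f a ≤ y}

theorem FrameHom.gc_rightAdjoint {α : Type u} {β : Type v} [Order.Frame α] [Order.Frame β]
    (f : FrameHom α β) : GaloisConnection f f.rightAdjoint := by
  intro a y
  constructor
  · intro h
    exact le_sSup h
  · intro h
    refine (OrderHomClass.mono f h).trans ?_
    rw [FrameHom.rightAdjoint, map_sSup]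
    refine sSup_le ?_
    rintro _ ⟨b, hb, rfl⟩
    exact hb

namespace FrameCongruence

variable {α : Type u} [Order.Frame α] (C : FrameCongruence α)

/-- The sublocale set `q_*[α / C]` of `α`, where `q : α → α / C` is the quotient map. It is a
frame in the order inherited from `α`. -/
def sublocale : Sublocale α where
  carrier := Set.range C.proj.rightAdjoint
  sInf_mem' S hS := by
    refine ⟨C.proj (sInf S), le_antisymm (le_sInf fun s hs => ?_)
      (C.proj.gc_rightAdjoint.le_u_l _)⟩
    obtain ⟨y, rfl⟩ := hS hs
    exact C.proj.gc_rightAdjoint.monotone_u (C.proj.gc_rightAdjoint.l_le (sInf_le hs))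
  himp_mem' := by
    rintro a _ ⟨y, rfl⟩
    refine ⟨C.proj a ⇨ y, eq_of_forall_le_iff fun b => ?_⟩
    rw [← C.proj.gc_rightAdjoint b, le_himp_iff, le_himp_iff, ← map_inf,
      C.proj.gc_rightAdjoint (b ⊓ a)]

/-- The frame quotient `a ↦ q_*(q(a))` of `α` onto `q_*[α / C]`. -/
def toSublocaleHom : FrameHom α C.sublocale :=
  have aux : ∀ a, (⟨C.proj.rightAdjoint (C.proj a), ⟨C.proj a, rfl⟩⟩ : C.sublocale) =
      C.sublocale.restrict a := by
    intro a
    refine eq_of_forall_ge_iff fun s => ?_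
    obtain ⟨_, y, rfl⟩ := s
    rw [C.sublocale.giRestrict.gc, ← Subtype.coe_le_coe]
    constructor
    · exact fun h => (C.proj.gc_rightAdjoint.le_u_l a).trans h
    · exact fun h => C.proj.gc_rightAdjoint.monotone_u ((C.proj.gc_rightAdjoint a y).2 h)
  { toFun := fun a => ⟨C.proj.rightAdjoint (C.proj a), ⟨C.proj a, rfl⟩⟩
    map_inf' := fun a b => by rw [aux, aux, aux, map_inf]
    map_top' := by rw [aux, map_top]
    map_sSup' := fun S => by
      rw [aux, map_sSup]
      exact congrArg sSup (Set.image_congr fun a _ => (aux a).symm) }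

theorem coe_toSublocaleHom (a : α) :
    (C.toSublocaleHom a : α) = C.proj.rightAdjoint (C.proj a) := rfl

theorem toSublocaleHom_surjective : Function.Surjective C.toSublocaleHom := by
  rintro ⟨_, y, rfl⟩
  obtain ⟨a, rfl⟩ := C.proj_surjective y
  exact ⟨a, rfl⟩

theorem toSublocaleHom_eq {a b : α} : C.toSublocaleHom a = C.toSublocaleHom b ↔ C.r a b := by
  rw [← C.proj_eq]
  constructor
  · intro h
    have h' : C.proj.rightAdjoint (C.proj a) = C.proj.rightAdjoint (C.proj b) :=
      congrArg Subtype.val h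
    exact le_antisymm ((C.proj.gc_rightAdjoint _ _).2 (h' ▸ C.proj.gc_rightAdjoint.le_u_l a))
      ((C.proj.gc_rightAdjoint _ _).2 (h' ▸ C.proj.gc_rightAdjoint.le_u_l b))
  · intro h
    exact Subtype.ext (congrArg C.proj.rightAdjoint h)

end FrameCongruence

/-! ### Biframes -/

/-- A subframe of a frame: a subset closed under finite meets (including the empty one) and
arbitrary joins. -/
structure Subframe (α : Type u) [Order.Frame α] where
  carrier : Set α
  top_mem : ⊤ ∈ carrier
  inf_mem : ∀ {a b : α}, a ∈ carrier → b ∈ carrier → a ⊓ b ∈ carrier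
  sSup_mem : ∀ S : Set α, S ⊆ carrier → sSup S ∈ carrier

/-- A biframe with ambient frame `α`: two subframes of `α` whose union is a subbasis of `α`, that
is, every element of `α` is a join of finite meets of elements of the union. -/
structure Biframe (α : Type u) [Order.Frame α] where
  fst : Subframe α
  snd : Subframe α
  subbasis : ∀ x : α, ∃ T : Set α,
    (∀ t ∈ T, ∃ F : Finset α, (F : Set α) ⊆ fst.carrier ∪ snd.carrier ∧ t = F.inf id) ∧
    x = sSup T

/-- A biframe homomorphism: a frame homomorphism of the ambient frames that maps each component
frame into the corresponding component frame. -/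
structure BiframeHom {α : Type u} {β : Type v} [Order.Frame α] [Order.Frame β]
    (L : Biframe α) (M : Biframe β) where
  toFrameHom : FrameHom α β
  map_fst : ∀ a ∈ L.fst.carrier, toFrameHom a ∈ M.fst.carrier
  map_snd : ∀ a ∈ L.snd.carrier, toFrameHom a ∈ M.snd.carrier

/-- Composition of biframe homomorphisms. -/
def BiframeHom.comp {α : Type u} {β : Type v} {γ : Type w}
    [Order.Frame α] [Order.Frame β] [Order.Frame γ]
    {L : Biframe α} {M : Biframe β} {N : Biframe γ}
    (g : BiframeHom M N) (f : BiframeHom L M) : BiframeHom L N where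
  toFrameHom := g.toFrameHom.comp f.toFrameHom
  map_fst a ha := g.map_fst _ (f.map_fst a ha)
  map_snd a ha := g.map_snd _ (f.map_snd a ha)

/-- The double pseudocomplement `a ↦ a**` as a nucleus; its range is the Booleanization. -/
def booleanNucleus (α : Type u) [Order.Frame α] : Nucleus α where
  toFun a := aᶜᶜ
  map_inf' a b := compl_compl_inf_distrib a b
  idempotent' a := by simp
  le_apply' _ := le_compl_compl

namespace Biframe

variable {α : Type u} [Order.Frame α] (L : Biframe α)

/-- The frame congruence of the ambient frame generated by the pairs `(a, a**)` with `a` in one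
of the two component frames; pseudocomplements are taken in the ambient frame. -/
def congr : FrameCongruence α :=
  FrameCongruence.generate fun a b => a ∈ L.fst.carrier ∪ L.snd.carrier ∧ b = aᶜᶜ

theorem compl_compl_eq_of_congr {a b : α} (h : L.congr.r a b) : aᶜᶜ = bᶜᶜ := by
  have := FrameCongruence.generate_le
    (FrameCongruence.ker (booleanNucleus α).toSublocale.restrict) (by
      rintro x _ ⟨-, rfl⟩
      change Sublocale.restrict _ _ = Sublocale.restrict _ _
      rw [Nucleus.restrict_toSublocale, Nucleus.restrict_toSublocale]
      exact Subtype.ext (compl_compl_compl xᶜ).symm) h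
  change Sublocale.restrict _ _ = Sublocale.restrict _ _ at this
  rw [Nucleus.restrict_toSublocale, Nucleus.restrict_toSublocale] at this
  exact congrArg Subtype.val this

/-- On the component frames, `q_*(q(a)) = a**`. -/
theorem toSublocaleHom_of_mem {a : α} (ha : a ∈ L.fst.carrier ∪ L.snd.carrier) :
    (L.congr.toSublocaleHom a : α) = aᶜᶜ := by
  have h : L.congr.proj a = L.congr.proj aᶜᶜ :=
    L.congr.proj_eq.2 (FrameCongruence.generate_of ⟨ha, rfl⟩)
  rw [FrameCongruence.coe_toSublocaleHom]
  refine le_antisymm ?_ ?_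
  · set b := L.congr.proj.rightAdjoint (L.congr.proj a)
    have hb : L.congr.r b a := L.congr.proj_eq.1
      (le_antisymm (L.congr.proj.gc_rightAdjoint.l_u_le _)
        (OrderHomClass.mono L.congr.proj (L.congr.proj.gc_rightAdjoint.le_u_l a)))
    exact le_compl_compl.trans (L.compl_compl_eq_of_congr hb).le
  · rw [h]
    exact L.congr.proj.gc_rightAdjoint.le_u_l _

/-- For a component frame `K` of the biframe, the set `{a** | a ∈ K}` of regularizations (taken in
the ambient frame), as a subframe of the frame `q_*[α / I]`. -/
def regularPart (K : Subframe α) (hK : K.carrier ⊆ L.fst.carrier ∪ L.snd.carrier) :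
    Subframe L.congr.sublocale :=
  have aux : {x : L.congr.sublocale | ∃ a ∈ K.carrier, (x : α) = aᶜᶜ} =
      L.congr.toSublocaleHom '' K.carrier := by
    ext x
    constructor
    · rintro ⟨a, ha, hx⟩
      exact ⟨a, ha, Subtype.ext ((L.toSublocaleHom_of_mem (hK ha)).trans hx.symm)⟩
    · rintro ⟨a, ha, rfl⟩
      exact ⟨a, ha, L.toSublocaleHom_of_mem (hK ha)⟩
  { carrier := {x | ∃ a ∈ K.carrier, (x : α) = aᶜᶜ}
    top_mem := by
      rw [aux]
      exact ⟨⊤, K.top_mem, map_top _⟩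
    inf_mem := by
      rw [aux]
      rintro _ _ ⟨a, ha, rfl⟩ ⟨b, hb, rfl⟩
      exact ⟨a ⊓ b, K.inf_mem ha hb, map_inf _ a b⟩
    sSup_mem := by
      rw [aux]
      intro S hS
      refine ⟨sSup {a | a ∈ K.carrier ∧ L.congr.toSublocaleHom a ∈ S},
        K.sSup_mem _ fun a ha => ha.1, ?_⟩
      rw [map_sSup]
      congr 1
      ext x
      constructor
      · rintro ⟨a, ⟨-, ha⟩, rfl⟩
        exact ha
      · intro hx
        obtain ⟨a, ha, rfl⟩ := hS hx
        exact ⟨a, ⟨ha, hx⟩, rfl⟩ }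

theorem toSublocaleHom_mem_regularPart {K : Subframe α}
    (hK : K.carrier ⊆ L.fst.carrier ∪ L.snd.carrier) {a : α} (ha : a ∈ K.carrier) :
    L.congr.toSublocaleHom a ∈ (L.regularPart K hK).carrier :=
  ⟨a, ha, L.toSublocaleHom_of_mem (hK ha)⟩

/-- The biframe `𝔅 L`: its ambient frame is `q_*[α / I]`, where `I = L.congr` and `q` is the
quotient map, and its component frames are `{a** | a ∈ L₁}` and `{a** | a ∈ L₂}`. -/
def leastDense : Biframe L.congr.sublocale where
  fst := L.regularPart L.fst Set.subset_union_left
  snd := L.regularPart L.snd Set.subset_union_right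
  subbasis := by
    classical
    intro x
    obtain ⟨y, rfl⟩ := L.congr.toSublocaleHom_surjective x
    obtain ⟨T, hT, rfl⟩ := L.subbasis y
    refine ⟨L.congr.toSublocaleHom '' T, ?_, map_sSup _ T⟩
    rintro _ ⟨t, ht, rfl⟩
    obtain ⟨F, hF, rfl⟩ := hT t ht
    refine ⟨F.image L.congr.toSublocaleHom, ?_, ?_⟩
    · intro z hz
      obtain ⟨a, ha, rfl⟩ := Finset.mem_image.1 hz
      rcases hF ha with h | h
      · exact Or.inl (L.toSublocaleHom_mem_regularPart Set.subset_union_left h)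
      · exact Or.inr (L.toSublocaleHom_mem_regularPart Set.subset_union_right h)
    · rw [map_finset_inf, Finset.inf_image]
      rfl

/-- The biframe homomorphism `β_L : L → 𝔅 L`, `a ↦ q_*(q(a))`. -/
def beta : BiframeHom L L.leastDense where
  toFrameHom := L.congr.toSublocaleHom
  map_fst _ ha := L.toSublocaleHom_mem_regularPart Set.subset_union_left ha
  map_snd _ ha := L.toSublocaleHom_mem_regularPart Set.subset_union_right ha

end Biframe

/-! On ambient frames, `beta` is a surjection whose kernel is exactly the congruence generated by
the pairs (a, a**) with a in a component of L. Hence β_M ∘ f factors through β_L as a frame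
homomorphism if and only if its kernel contains these pairs
(`FrameHom.exists_comp_eq_of_surjective`, together with leastness of the congruence). Since a ≤ a**,
such a pair lies in the kernel as soon as β_M(f(a**)) ≤ β_M(f(a)). As f(a) lies in a component of M,
β_M(f(a)) = f(a)**, and the adjunction turns this inequality into f(a**) ≤ f(a)**
(`toSublocaleHom_le_iff`). The components impose no further condition: those of 𝔅L are the images
under β_L of those of L. -/

/-- A frame homomorphism factors through a surjective one whose kernel is contained in its own. -/
theorem FrameHom.exists_comp_eq_of_surjective {α : Type u} {β : Type v} {γ : Type w}
    [Order.Frame α] [Order.Frame β] [Order.Frame γ] (g : FrameHom α β) (h : FrameHom α γ)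
    (hg : Function.Surjective g) (hgh : ∀ a b, g a = g b → h a = h b) :
    ∃ k : FrameHom β γ, k.comp g = h := by
  -- The kernel inclusion makes the value of `h` independent of the chosen preimage, so each
  -- preservation law can be checked on arbitrary preimages under `g`.
  have key : ∀ a, h (Function.surjInv hg (g a)) = h a := fun a =>
    hgh _ _ (Function.surjInv_eq hg (g a))
  refine ⟨{ toFun := fun y => h (Function.surjInv hg y)
            map_inf' := fun x y => ?_
            map_top' := ?_
            map_sSup' := fun S => ?_ }, FrameHom.ext key⟩
  · obtain ⟨a, rfl⟩ := hg x
    obtain ⟨b, rfl⟩ := hg y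
    rw [← map_inf g, key, key, key, map_inf]
  · rw [← map_top g, key, map_top]
  · obtain ⟨T, rfl⟩ := hg.image_surjective S
    rw [← map_sSup g, key, map_sSup, Set.image_image]
    exact congrArg sSup (Set.image_congr fun a _ => (key a).symm)

theorem BiframeHom.toFrameHom_injective {α : Type u} {β : Type v} [Order.Frame α] [Order.Frame β]
    {L : Biframe α} {M : Biframe β} :
    Function.Injective (BiframeHom.toFrameHom : BiframeHom L M → FrameHom α β) := by
  rintro ⟨f, _, _⟩ ⟨g, _, _⟩ h
  cases h
  rfl

theorem BiframeHom.map_mem_union {α : Type u} {β : Type v} [Order.Frame α] [Order.Frame β]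
    {L : Biframe α} {M : Biframe β} (f : BiframeHom L M) {a : α}
    (ha : a ∈ L.fst.carrier ∪ L.snd.carrier) :
    f.toFrameHom a ∈ M.fst.carrier ∪ M.snd.carrier :=
  ha.imp (f.map_fst a) (f.map_snd a)

namespace Biframe

variable {α : Type u} [Order.Frame α] (L : Biframe α)

/-- The pair (a, a**) is one of the generators of the congruence. -/
theorem toSublocaleHom_compl_compl {a : α} (ha : a ∈ L.fst.carrier ∪ L.snd.carrier) :
    L.congr.toSublocaleHom aᶜᶜ = L.congr.toSublocaleHom a :=
  (L.congr.toSublocaleHom_eq.2 (FrameCongruence.generate_of ⟨ha, rfl⟩)).symm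

theorem exists_eq_toSublocaleHom_of_mem_regularPart {K : Subframe α}
    (hK : K.carrier ⊆ L.fst.carrier ∪ L.snd.carrier) {x : L.congr.sublocale}
    (hx : x ∈ (L.regularPart K hK).carrier) : ∃ a ∈ K.carrier, L.congr.toSublocaleHom a = x := by
  obtain ⟨a, ha, hxa⟩ := hx
  exact ⟨a, ha, Subtype.ext ((L.toSublocaleHom_of_mem (hK ha)).trans hxa.symm)⟩

/-- For `b` in a component frame, `q_*(q(a)) ≤ q_*(q(b))` if and only if `a ≤ b**`. -/
theorem toSublocaleHom_le_iff {a b : α} (hb : b ∈ L.fst.carrier ∪ L.snd.carrier) :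
    L.congr.toSublocaleHom a ≤ L.congr.toSublocaleHom b ↔ a ≤ bᶜᶜ := by
  constructor
  · intro h
    -- Here b** = q_*(q(b)), so the unit a ≤ q_*(q(a)) of the adjunction suffices.
    rw [← L.toSublocaleHom_of_mem hb]
    exact (L.congr.proj.gc_rightAdjoint.le_u_l a).trans h
  · intro h
    rw [← L.toSublocaleHom_compl_compl hb]
    exact OrderHomClass.mono L.congr.toSublocaleHom h

end Biframe

theorem mainTheorem7 {α : Type u} {β : Type v} [Order.Frame α] [Order.Frame β]
    (L : Biframe α) (M : Biframe β) (f : BiframeHom L M) :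
    (∃ fhat : BiframeHom L.leastDense M.leastDense, fhat.comp L.beta = M.beta.comp f) ↔
      ∀ a ∈ L.fst.carrier ∪ L.snd.carrier, f.toFrameHom aᶜᶜ ≤ (f.toFrameHom a)ᶜᶜ := by
  constructor
  · rintro ⟨fhat, h⟩ a ha
    have key (b : α) : fhat.toFrameHom (L.congr.toSublocaleHom b) =
        M.congr.toSublocaleHom (f.toFrameHom b) :=
      DFunLike.congr_fun (congrArg BiframeHom.toFrameHom h) b
    -- Both sides become values of `fhat`, at β_L(a**) and at β_L(a), and these two arguments
    -- coincide.
    rw [← M.toSublocaleHom_le_iff (f.map_mem_union ha), ← key, ← key,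
      L.toSublocaleHom_compl_compl ha]
  · intro h
    obtain ⟨k, hk⟩ := FrameHom.exists_comp_eq_of_surjective L.congr.toSublocaleHom
      (M.congr.toSublocaleHom.comp f.toFrameHom) L.congr.toSublocaleHom_surjective (by
        intro a b hab
        -- By leastness of the congruence, it is enough that the kernel of β_M ∘ f contains the
        -- generating pairs.
        refine FrameCongruence.generate_le
          (FrameCongruence.ker (M.congr.toSublocaleHom.comp f.toFrameHom)) ?_
          (L.congr.toSublocaleHom_eq.1 hab)
        rintro x _ ⟨hx, rfl⟩
        exact le_antisymm
          (OrderHomClass.mono (M.congr.toSublocaleHom.comp f.toFrameHom) le_compl_compl)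
          ((M.toSublocaleHom_le_iff (f.map_mem_union hx)).2 (h x hx)))
    have key (a : α) : k (L.congr.toSublocaleHom a) =
        M.congr.toSublocaleHom (f.toFrameHom a) := DFunLike.congr_fun hk a
    refine ⟨⟨k, fun x hx => ?_, fun x hx => ?_⟩, BiframeHom.toFrameHom_injective hk⟩
    -- An element of a component of 𝔅L is β_L(a) with a in the matching component of L, so `k` sends
    -- it to β_M(f(a)).
    · obtain ⟨a, ha, rfl⟩ := L.exists_eq_toSublocaleHom_of_mem_regularPart Set.subset_union_left hx
      rw [key]
      exact M.beta.map_fst _ (f.map_fst a ha)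
    · obtain ⟨a, ha, rfl⟩ := L.exists_eq_toSublocaleHom_of_mem_regularPart Set.subset_union_right hx
      rw [key]
      exact M.beta.map_snd _ (f.map_snd a ha)
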